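/- Consider the variable-length crane with cart mass $M>0$, payload mass $m>0$ and gravitational acceleration $g>0$. Its state is $X=(x,\dot x,\theta,\dot\theta,l,\dot l)^T$ with payload length $l>0$, its input is $F=(f_1,f_2)^T$, and its dynamics are $$\dot X=\begin{bmatrix}\dot x\\0\\\dot\theta\\-\frac{2}{l}\dot l\dot\theta-\frac{g}{l}\sin\theta\\\dot l\\l\dot\theta^2+g\cos\theta\end{bmatrix}+\begin{bmatrix}0&0\\\frac1M&\frac{-\sin\theta}{M}\\0&0\\\frac{-\cos\theta}{Ml}&\frac{\sin\theta\cos\theta}{Ml}\\0&0\\\frac{-\sin\theta}{M}&\frac{\sin^2\theta}{M}+\frac1m\end{bmatrix}F .$$ Let $x_0\in\mathbb R$ and $l_0>0$, and put $X_{eq}=(x_0,0,0,0,l_0,0)^T$ and $F_{eq}=(0,-mg)^T$. Let $k_1,\dots,k_6\in\mathbb R$ satisfy $$k_1>0,\qquad k_2l_0-k_4>0,\qquad \frac{-k_4Mg}{k_2l_0-k_4}+k_1l_0-k_3+mg>0,$$ $$\frac{-k_2k_4Mg+(k_2l_0-k_4)(k_1k_4-k_2k_3+k_2mg)}{-k_4Mg+(k_2l_0-k_4)(k_1l_0-k_3+mg)}>0,\qquad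 k_5>0,\qquad k_6>0 .$$ Then $X_{eq}$ is an equilibrium for the constant input $F_{eq}$, and the partial state feedback $$F=F_{eq}-K(X-X_{eq}),\qquad K=\begin{bmatrix}k_1&k_2&k_3&k_4&0&0\\0&0&0&0&k_5&k_6\end{bmatrix},$$ stabilizes the system about $X_{eq}$: $X_{eq}$ is a locally exponentially stable equilibrium of the resulting nonlinear closed-loop system. That is, there are $\delta,C,\alpha>0$ such that from every initial state $X(0)$ with $l(0)>0$ and $\|X(0)-X_{eq}\|<\delta$ there is a solution with $l>0$ for all $t\ge 0$, and every solution from such a state, on any interval $[0,T)$ on which it is defined, satisfies $\|X(t)-X_{eq}\|\le Ce^{-\alpha t}\|X(0)-X_{eq}\|$. -/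

import Mathlib

open Matrix

/-- `γ` solves the autonomous equation `γ' = v(γ)` on the time set `I` and stays in the phase
space `D`.  At a left endpoint of `I` the derivative is the one-sided one. -/
def IsSolutionOn {E : Type*} [NormedAddCommGroup E] [NormedSpace ℝ E]
    (v : E → E) (D : Set E) (γ : ℝ → E) (I : Set ℝ) : Prop :=
  IsIntegralCurveOn γ (fun _ y => v y) I ∧ ∀ t ∈ I, γ t ∈ D

/-- `xe` is a (locally) exponentially stable equilibrium of `x' = v(x)` on the phase space `D`:
it is an equilibrium, every initial state near `xe` has a solution for all times `t ≥ 0`, and every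
solution from such a state, on whatever interval `[0, T)` it is defined, satisfies
`‖x(t) - xe‖ ≤ C exp (-α t) ‖x(0) - xe‖`.
In finite dimension this does not depend on the norm; it contains Lyapunov stability and
local attractivity, that is, asymptotic stability. -/
def IsExponentiallyStableEquilibrium {E : Type*} [NormedAddCommGroup E] [NormedSpace ℝ E]
    (v : E → E) (D : Set E) (xe : E) : Prop :=
  xe ∈ D ∧ v xe = 0 ∧
    ∃ δ > 0, ∃ C > 0, ∃ α > 0, ∀ a ∈ D, ‖a - xe‖ < δ →
      (∃ γ : ℝ → E, γ 0 = a ∧ IsSolutionOn v D γ (Set.Ici 0)) ∧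
      ∀ (T : ℝ) (γ : ℝ → E), γ 0 = a → IsSolutionOn v D γ (Set.Ico 0 T) →
        ∀ t ∈ Set.Ico 0 T, ‖γ t - xe‖ ≤ C * Real.exp (-α * t) * ‖a - xe‖

namespace Crane

/-- The states `X = (x, x', θ, θ', l, l')` with positive payload length `l`. -/
def phaseSpace : Set (Fin 6 → ℝ) := {X | 0 < X 4}

/-- The drift `f(X)` of the variable-length crane, with gravitational acceleration `grav`. -/
noncomputable def drift (grav : ℝ) (X : Fin 6 → ℝ) : Fin 6 → ℝ :=
  ![X 1,
    0,
    X 3,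
    -(2 / X 4) * X 5 * X 3 - grav / X 4 * Real.sin (X 2),
    X 5,
    X 4 * X 3 ^ 2 + grav * Real.cos (X 2)]

/-- The input matrix `g(X)` of the crane, with cart mass `M` and payload mass `m`. -/
noncomputable def inputMatrix (M m : ℝ) (X : Fin 6 → ℝ) : Matrix (Fin 6) (Fin 2) ℝ :=
  !![0, 0;
     1 / M, -Real.sin (X 2) / M;
     0, 0;
     -Real.cos (X 2) / (M * X 4), Real.sin (X 2) * Real.cos (X 2) / (M * X 4);
     0, 0;
     -Real.sin (X 2) / M, Real.sin (X 2) ^ 2 / M + 1 / m]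

/-- The right-hand side `f(X) + g(X) F` of the crane dynamics, with input `F = (f₁, f₂)`. -/
noncomputable def dynamics (M m grav : ℝ) (X : Fin 6 → ℝ) (F : Fin 2 → ℝ) : Fin 6 → ℝ :=
  drift grav X + inputMatrix M m X *ᵥ F

/-- The equilibrium state with cart position `x₀` and payload length `l₀`. -/
def eqState (x₀ l₀ : ℝ) : Fin 6 → ℝ := ![x₀, 0, 0, 0, l₀, 0]

/-- The equilibrium input `(0, -m grav)`. -/
def eqInput (m grav : ℝ) : Fin 2 → ℝ := ![0, -(m * grav)]

/-- The gain matrix `K` of the partial state feedback. -/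
def gain (k₁ k₂ k₃ k₄ k₅ k₆ : ℝ) : Matrix (Fin 2) (Fin 6) ℝ :=
  !![k₁, k₂, k₃, k₄, 0, 0;
     0, 0, 0, 0, k₅, k₆]

/-- The crane with the feedback applied about the equilibrium: the input is
`F = F_eq + F_fb`, where `F_fb = -K (X - X_eq)`. -/
noncomputable def closedLoop (M m grav x₀ l₀ : ℝ) (K : Matrix (Fin 2) (Fin 6) ℝ)
    (X : Fin 6 → ℝ) : Fin 6 → ℝ :=
  dynamics M m grav X (eqInput m grav + -(K *ᵥ (X - eqState x₀ l₀)))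

end Crane

/-! The proof is Lyapunov's indirect method with an explicit quadratic form.

At the equilibrium the linearized closed loop splits. The length obeys a damped oscillator, with
positive coefficients `k₆ / m` and `k₅ / m`. The cart and pendulum form one quartic equation for `z
= x + l₀ θ`: the cart acceleration drops out of `z'' = -grav θ`, so `z` and its first three
derivatives are coordinates. The hypotheses on `k₁, …, k₄` are the Routh conditions for this
quartic.

Routh conditions give a Schwarz matrix with positive parameters, for which a weighted sum of squares
is nonincreasing but only weakly dissipated. Strict decay comes from shifting the spectrum by a
small `ε` first: the conditions are open, and weak decay of the shifted system is decay at rate `ε`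
of the original one (`Crane.exists_quadratic_lyapunov`). Half of this margin absorbs the nonlinear
remainder in `isExponentiallyStableEquilibrium_of_quadratic`; a bounded Lipschitz cutoff of the
field supplies global solutions, trapped where both fields agree. -/

/-! ### Global solutions and cutoff of the vector field -/

open Filter Topology in
/-- A bounded Lipschitz autonomous vector field has forward integral curves for all times. -/
theorem exists_isIntegralCurveOn_Ici_of_lipschitzWith
    {E : Type*} [NormedAddCommGroup E] [NormedSpace ℝ E] [CompleteSpace E]
    {w : E → E} {K : NNReal} (hK : LipschitzWith K w) {B : ℝ} (hB : ∀ x, ‖w x‖ ≤ B) (a : E) :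
    ∃ γ : ℝ → E, γ 0 = a ∧ IsIntegralCurveOn γ (fun _ y => w y) (Set.Ici 0) := by
  lift B to NNReal using (norm_nonneg _).trans (hB a)
  have hex : ∀ n : ℕ, ∃ γ : ℝ → E, γ 0 = a ∧
      ∀ t ∈ Set.Icc (0 : ℝ) n, HasDerivWithinAt γ (w (γ t)) (Set.Icc 0 (n : ℝ)) t := by
    intro n
    -- Speed at most `B` keeps curves within `B * n` of `a` up to time `n`, so this radius imposes
    -- no smallness on the interval.
    have hp : IsPicardLindelof (fun _ => w) (tmin := 0) (tmax := n)
        ⟨0, by simp⟩ a (B * n) 0 B K := by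
      refine IsPicardLindelof.of_time_independent (fun x _ => hB x) hK.lipschitzOnWith ?_
      simp
    exact hp.exists_eq_forall_mem_Icc_hasDerivWithinAt₀
  choose γ hγ0 hγ using hex
  have hcont : ∀ n : ℕ, ContinuousOn (γ n) (Set.Icc 0 (n : ℝ)) := fun n t ht =>
    (hγ n t ht).continuousWithinAt
  have hright : ∀ n : ℕ, ∀ t ∈ Set.Ico (0 : ℝ) n,
      HasDerivWithinAt (γ n) (w (γ n t)) (Set.Ici t) t := by
    intro n t ht
    refine (hγ n t ⟨ht.1, ht.2.le⟩).mono_of_mem_nhdsWithin ?_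
    exact mem_of_superset (Icc_mem_nhdsGE ht.2) (Set.Icc_subset_Icc_left ht.1)
  have huniq : ∀ m n : ℕ, m ≤ n → Set.EqOn (γ m) (γ n) (Set.Icc 0 (m : ℝ)) := by
    intro m n hmn
    have hmn' : (m : ℝ) ≤ n := by exact_mod_cast hmn
    exact ODE_solution_unique_of_mem_Icc_right (v := fun _ => w) (s := fun _ => Set.univ)
      (fun _ _ => hK.lipschitzOnWith) (hcont m) (hright m) (fun _ _ => trivial)
      ((hcont n).mono (Set.Icc_subset_Icc_right hmn'))
      (fun t ht => hright n t ⟨ht.1, ht.2.trans_le hmn'⟩) (fun _ _ => trivial)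
      ((hγ0 m).trans (hγ0 n).symm)
  have heq : ∀ n : ℕ, ∀ s ∈ Set.Ico (0 : ℝ) n, γ (⌊s⌋₊ + 1) s = γ n s := by
    intro n s hs
    refine huniq _ n ?_ ⟨hs.1, ?_⟩
    · exact (Nat.floor_lt hs.1).2 hs.2
    · push_cast
      exact (Nat.lt_floor_add_one s).le
  refine ⟨fun s => γ (⌊s⌋₊ + 1) s, by simpa using hγ0 1, fun t ht => ?_⟩
  have ht0 : (0 : ℝ) ≤ t := ht
  obtain ⟨n, hn⟩ := exists_nat_gt t
  have hIcc : Set.Icc (0 : ℝ) n ∈ 𝓝[Set.Ici 0] t := by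
    rw [← Set.Ici_inter_Iic]
    exact inter_mem self_mem_nhdsWithin (mem_nhdsWithin_of_mem_nhds (Iic_mem_nhds hn))
  have hIco : Set.Ico (0 : ℝ) n ∈ 𝓝[Set.Ici 0] t := by
    rw [← Set.Ici_inter_Iio]
    exact inter_mem self_mem_nhdsWithin (mem_nhdsWithin_of_mem_nhds (Iio_mem_nhds hn))
  have hd := (hγ n t ⟨ht0, hn.le⟩).mono_of_mem_nhdsWithin hIcc
  have het : γ (⌊t⌋₊ + 1) t = γ n t := heq n t ⟨ht0, hn⟩
  change HasDerivWithinAt (fun s => γ (⌊s⌋₊ + 1) s) (w (γ (⌊t⌋₊ + 1) t)) (Set.Ici 0) t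
  rw [het]
  exact hd.congr_of_eventuallyEq (by filter_upwards [hIco] with s hs using heq n s hs) het

open Filter Topology in
/-- A vector field that is `C¹` at a point agrees near it with a bounded Lipschitz field. -/
theorem ContDiffAt.exists_lipschitzWith_bounded_eqOn_ball
    {E : Type*} [NormedAddCommGroup E] [NormedSpace ℝ E] [FiniteDimensional ℝ E]
    {v : E → E} {x : E} (hv : ContDiffAt ℝ 1 v x) :
    ∃ r > 0, ∃ w : E → E, (∃ K, LipschitzWith K w) ∧ (∃ B, ∀ y, ‖w y‖ ≤ B) ∧
      Set.EqOn w v (Metric.ball x r) := by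
  obtain ⟨R, hR, hRv⟩ := Metric.eventually_nhds_iff_ball.1 (hv.eventually (by simp))
  let φ : ContDiffBump x := ⟨R / 4, R / 2, by positivity, by linarith⟩
  have hts : tsupport (fun y => φ y • v y) ⊆ Metric.closedBall x (R / 2) := by
    rw [← φ.tsupport_eq]
    exact tsupport_smul_subset_left (φ : E → ℝ) v
  have hw : ContDiff ℝ 1 fun y => φ y • v y := by
    refine contDiff_iff_contDiffAt.2 fun y => ?_
    by_cases hy : y ∈ tsupport fun y => φ y • v y
    swap
    · exact contDiffAt_const.congr_of_eventuallyEq (notMem_tsupport_iff_eventuallyEq.1 hy)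
    refine φ.contDiffAt.smul (hRv y ?_)
    exact Metric.closedBall_subset_ball (by linarith) (hts hy)
  have hcs : HasCompactSupport fun y => φ y • v y := φ.hasCompactSupport.smul_right
  refine ⟨R / 4, by positivity, fun y => φ y • v y,
    ContDiff.lipschitzWith_of_hasCompactSupport hcs hw one_ne_zero,
    hcs.exists_bound_of_continuous hw.continuous, fun y hy => ?_⟩
  have h1 : φ y = 1 := φ.one_of_mem_closedBall (Metric.ball_subset_closedBall hy)
  simp [h1]

/-! ### Quadratic Lyapunov functions and the indirect method -/

/-- If a positive definite quadratic form decays along a vector field inside a ball, then it decays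
exponentially along integral curves that start in a sublevel set contained in the ball. -/
theorem IsIntegralCurveOn.quadratic_le_exp
    {E : Type*} [NormedAddCommGroup E] [NormedSpace ℝ E]
    {Q : E →L[ℝ] E →L[ℝ] ℝ} (hsymm : ∀ x y, Q x y = Q y x) {c ε r : ℝ} (hc : 0 < c) (hε : 0 < ε)
    (hr : 0 < r) (hQ : ∀ x, c * ‖x‖ ^ 2 ≤ Q x x) {w : E → E} {xe : E}
    (hdec : ∀ y ∈ Metric.ball xe r, Q (y - xe) (w y) ≤ -ε * Q (y - xe) (y - xe))
    {T : ℝ} {γ : ℝ → E} (hγ : IsIntegralCurveOn γ (fun _ y => w y) (Set.Ico 0 T))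
    (h0 : Q (γ 0 - xe) (γ 0 - xe) < c * r ^ 2) {t : ℝ} (ht : t ∈ Set.Ico 0 T) :
    Q (γ t - xe) (γ t - xe) ≤ Q (γ 0 - xe) (γ 0 - xe) * Real.exp (-ε * t) := by
  set W : ℝ → ℝ := fun s => Q (γ s - xe) (γ s - xe) with hW
  have hW0 : 0 ≤ W 0 := le_trans (by positivity) (hQ _)
  have hd : ∀ s ∈ Set.Ico 0 T,
      HasDerivWithinAt W (2 * Q (γ s - xe) (w (γ s))) (Set.Ico 0 T) s := by
    intro s hs
    have h1 : HasDerivWithinAt (fun s => γ s - xe) (w (γ s)) (Set.Ico 0 T) s :=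
      (hγ s hs).sub_const xe
    have h2 := (Q.hasFDerivAt.comp_hasDerivWithinAt s h1).clm_apply h1
    refine h2.congr_deriv ?_
    simp only [Function.comp_apply]
    rw [hsymm (w (γ s))]
    ring
  -- The slack `η` keeps the barrier positive even if `W 0 = 0`. At a contact `W' ≤ -2 ε W < -ε W`,
  -- which is the strict inequality needed; the decay hypothesis is used only there, where the
  -- barrier itself places the point in the ball.
  have key : ∀ η > 0, W 0 + η < c * r ^ 2 → W t ≤ (W 0 + η) * Real.exp (-ε * t) := by
    intro η hη hηr
    have hBd : ∀ s : ℝ, HasDerivAt (fun s => (W 0 + η) * Real.exp (-ε * s))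
        (-ε * ((W 0 + η) * Real.exp (-ε * s))) s := by
      intro s
      have := (((hasDerivAt_id s).const_mul (-ε)).exp).const_mul (W 0 + η)
      refine this.congr_deriv ?_
      simp only [id]
      ring
    have hsub : Set.Icc 0 t ⊆ Set.Ico 0 T := Set.Icc_subset_Ico_right ht.2
    refine image_le_of_deriv_right_lt_deriv_boundary' (f' := fun s => 2 * Q (γ s - xe) (w (γ s)))
      (B := fun s => (W 0 + η) * Real.exp (-ε * s))
      (B' := fun s => -ε * ((W 0 + η) * Real.exp (-ε * s)))
      (fun s hs => ((hd s (hsub hs)).continuousWithinAt).mono hsub)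
      (fun s hs => ?_) (by simpa using hη.le)
      (fun s _ => (hBd s).continuousAt.continuousWithinAt)
      (fun s _ => (hBd s).hasDerivWithinAt) (fun s hs hWB => ?_) ⟨ht.1, le_rfl⟩
    · refine (hd s (hsub ⟨hs.1, hs.2.le⟩)).mono_of_mem_nhdsWithin ?_
      exact Filter.mem_of_superset (Ico_mem_nhdsGE (hs.2.trans ht.2))
        (Set.Ico_subset_Ico_left hs.1)
    · have hpos : 0 < (W 0 + η) * Real.exp (-ε * s) := by positivity
      have hle : (W 0 + η) * Real.exp (-ε * s) ≤ W 0 + η := by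
        refine mul_le_of_le_one_right (by positivity) (Real.exp_le_one_iff.2 ?_)
        nlinarith [hs.1]
      have hball : γ s ∈ Metric.ball xe r := by
        rw [mem_ball_iff_norm]
        refine lt_of_pow_lt_pow_left₀ 2 hr.le (lt_of_mul_lt_mul_left ?_ hc.le)
        exact ((hQ _).trans (hWB.le.trans hle)).trans_lt hηr
      have := hdec _ hball
      change W s = _ at hWB
      change _ ≤ -ε * W s at this
      change 2 * _ < -ε * _
      rw [hWB] at this
      nlinarith
  have hlim : Filter.Tendsto (fun η => (W 0 + η) * Real.exp (-ε * t)) (nhdsWithin 0 (Set.Ioi 0))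
      (nhds (W 0 * Real.exp (-ε * t))) := by
    have : Continuous fun η => (W 0 + η) * Real.exp (-ε * t) := by fun_prop
    simpa using (this.tendsto 0).mono_left nhdsWithin_le_nhds
  refine ge_of_tendsto hlim ?_
  filter_upwards [Ioo_mem_nhdsGT (sub_pos.2 h0)] with η hη
  exact key η hη.1 (by have := hη.2; change η < _ - W 0 at this; linarith)

/-- A continuous quadratic form that is positive on nonzero vectors of a finite-dimensional space
dominates a positive multiple of the squared norm. -/
theorem ContinuousLinearMap.exists_pos_mul_norm_sq_le
    {E : Type*} [NormedAddCommGroup E] [NormedSpace ℝ E] [FiniteDimensional ℝ E]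
    (Q : E →L[ℝ] E →L[ℝ] ℝ) (hpos : ∀ x, x ≠ 0 → 0 < Q x x) :
    ∃ c > 0, ∀ x, c * ‖x‖ ^ 2 ≤ Q x x := by
  have : ProperSpace E := FiniteDimensional.proper ℝ E
  have hcont : Continuous fun x => Q x x := by fun_prop
  rcases (Metric.sphere (0 : E) 1).eq_empty_or_nonempty with he | hne
  · refine ⟨1, one_pos, fun x => ?_⟩
    have hx : x = 0 := by
      by_contra hx
      have : ‖x‖⁻¹ • x ∈ Metric.sphere (0 : E) 1 := by
        rw [mem_sphere_zero_iff_norm, norm_smul, norm_inv, norm_norm,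
          inv_mul_cancel₀ (norm_ne_zero_iff.2 hx)]
      simp [he] at this
    simp [hx]
  · obtain ⟨x₀, hx₀, hmin⟩ := (isCompact_sphere (0 : E) 1).exists_isMinOn hne hcont.continuousOn
    refine ⟨Q x₀ x₀, hpos x₀ (ne_zero_of_mem_unit_sphere ⟨x₀, hx₀⟩), fun x => ?_⟩
    rcases eq_or_ne x 0 with rfl | hx
    · simp
    have hn : 0 < ‖x‖ := norm_pos_iff.2 hx
    have hmem : ‖x‖⁻¹ • x ∈ Metric.sphere (0 : E) 1 := by
      rw [mem_sphere_zero_iff_norm, norm_smul, norm_inv, norm_norm, inv_mul_cancel₀ hn.ne']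
    have hle : Q x₀ x₀ ≤ Q (‖x‖⁻¹ • x) (‖x‖⁻¹ • x) := hmin hmem
    simp only [map_smul, _root_.smul_apply, smul_eq_mul] at hle
    calc Q x₀ x₀ * ‖x‖ ^ 2 ≤ ‖x‖⁻¹ * (‖x‖⁻¹ * Q x x) * ‖x‖ ^ 2 := by gcongr
      _ = Q x x := by field_simp

open Filter Topology in
/-- **Lyapunov's indirect method**: an equilibrium of a `C¹` vector field is exponentially stable
if some positive definite quadratic form decays strictly along the linearized field. -/
theorem isExponentiallyStableEquilibrium_of_quadratic
    {E : Type*} [NormedAddCommGroup E] [NormedSpace ℝ E] [FiniteDimensional ℝ E]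
    {v : E → E} {D : Set E} {xe : E} (hD : D ∈ 𝓝 xe) (hv0 : v xe = 0) (hv : ContDiffAt ℝ 1 v xe)
    {Q : E →L[ℝ] E →L[ℝ] ℝ} (hsymm : ∀ x y, Q x y = Q y x) (hpos : ∀ x, x ≠ 0 → 0 < Q x x)
    {ε : ℝ} (hε : 0 < ε) (hdec : ∀ x, Q x (fderiv ℝ v xe x) ≤ -ε * Q x x) :
    IsExponentiallyStableEquilibrium v D xe := by
  have : CompleteSpace E := FiniteDimensional.complete ℝ E
  obtain ⟨c, hc, hQ⟩ := Q.exists_pos_mul_norm_sq_le hpos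
  have hnear : ∀ᶠ y in 𝓝 xe, Q (y - xe) (v y) ≤ -(ε / 2) * Q (y - xe) (y - xe) := by
    -- Chosen so that `‖Q‖` times the linearization error costs at most `ε / 2 * Q h h`.
    have hη : 0 < ε / 2 * c / (‖Q‖ + 1) := by positivity
    have hlo := (hv.differentiableAt one_ne_zero).hasFDerivAt.isLittleO.def hη
    filter_upwards [hlo] with y hy
    rw [hv0, sub_zero] at hy
    set h := y - xe
    have h1 : Q h (v y - fderiv ℝ v xe h) ≤ ε / 2 * Q h h := by
      calc Q h (v y - fderiv ℝ v xe h) ≤ ‖Q h (v y - fderiv ℝ v xe h)‖ := Real.le_norm_self _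
        _ ≤ ‖Q‖ * ‖h‖ * ‖v y - fderiv ℝ v xe h‖ := Q.le_opNorm₂ _ _
        _ ≤ (‖Q‖ + 1) * ‖h‖ * (ε / 2 * c / (‖Q‖ + 1) * ‖h‖) := by gcongr; linarith
        _ = ε / 2 * (c * ‖h‖ ^ 2) := by field_simp
        _ ≤ ε / 2 * Q h h := by gcongr; exact hQ h
    rw [map_sub] at h1
    linarith [hdec h]
  obtain ⟨r₁, hr₁, w, ⟨K, hK⟩, ⟨B, hB⟩, hwv⟩ := hv.exists_lipschitzWith_bounded_eqOn_ball
  obtain ⟨r₂, hr₂, hr₂'⟩ := Metric.eventually_nhds_iff_ball.1 (hnear.and hD)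
  set r := min r₁ r₂
  have hr : 0 < r := lt_min hr₁ hr₂
  have hball₁ : Metric.ball xe r ⊆ Metric.ball xe r₁ := Metric.ball_subset_ball (min_le_left _ _)
  have hball₂ : Metric.ball xe r ⊆ Metric.ball xe r₂ := Metric.ball_subset_ball (min_le_right _ _)
  have hvdec : ∀ y ∈ Metric.ball xe r, Q (y - xe) (v y) ≤ -(ε / 2) * Q (y - xe) (y - xe) :=
    fun y hy => (hr₂' y (hball₂ hy)).1
  have hwdec : ∀ y ∈ Metric.ball xe r, Q (y - xe) (w y) ≤ -(ε / 2) * Q (y - xe) (y - xe) :=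
    fun y hy => by rw [hwv (hball₁ hy)]; exact hvdec y hy
  set C := Real.sqrt ((‖Q‖ + 1) / c) with hCdef
  have hC : 0 < C := Real.sqrt_pos.2 (by positivity)
  have hC2 : C ^ 2 * c = ‖Q‖ + 1 := by
    rw [hCdef, Real.sq_sqrt (by positivity), div_mul_cancel₀ _ hc.ne']
  have hQle : ∀ x, Q x x ≤ C ^ 2 * c * ‖x‖ ^ 2 := by
    intro x
    calc Q x x ≤ ‖Q x x‖ := Real.le_norm_self _
      _ ≤ ‖Q‖ * ‖x‖ * ‖x‖ := Q.le_opNorm₂ _ _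
      _ ≤ C ^ 2 * c * ‖x‖ ^ 2 := by rw [hC2]; nlinarith [sq_nonneg ‖x‖]
  have hstart : ∀ a, ‖a - xe‖ < r / C → Q (a - xe) (a - xe) < c * r ^ 2 := by
    intro a ha
    rw [lt_div_iff₀ hC] at ha
    calc Q (a - xe) (a - xe) ≤ C ^ 2 * c * ‖a - xe‖ ^ 2 := hQle _
      _ = c * (‖a - xe‖ * C) ^ 2 := by ring
      _ < c * r ^ 2 := by gcongr
  -- `C` compares the upper and lower bounds of `Q`, so radius `r / C` lands in a sublevel set
  -- inside the ball. The form decays at rate `ε / 2`, hence the norm at `ε / 4`.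
  refine ⟨mem_of_mem_nhds hD, hv0, r / C, by positivity, C, hC, ε / 4, by positivity,
    fun a _ har => ⟨?_, fun T γ h0 hγ t ht => ?_⟩⟩
  · obtain ⟨γ, h0, hγ⟩ := exists_isIntegralCurveOn_Ici_of_lipschitzWith hK hB a
    have hmem : ∀ t ∈ Set.Ici (0 : ℝ), γ t ∈ Metric.ball xe r := by
      intro t ht
      have hle := (hγ.mono Set.Ico_subset_Ici_self).quadratic_le_exp hsymm hc (half_pos hε) hr hQ
        hwdec (by rw [h0]; exact hstart a har) (T := t + 1) (t := t) ⟨ht, by linarith⟩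
      rw [h0] at hle
      rw [mem_ball_iff_norm]
      refine lt_of_pow_lt_pow_left₀ 2 hr.le (lt_of_mul_lt_mul_left ?_ hc.le)
      refine (hQ _).trans_lt (lt_of_le_of_lt ?_ (hstart a har))
      refine hle.trans (mul_le_of_le_one_right (le_trans (by positivity) (hQ _)) ?_)
      have ht0 : (0 : ℝ) ≤ t := ht
      exact Real.exp_le_one_iff.2 (by nlinarith)
    refine ⟨γ, h0, fun t ht => ?_, fun t ht => (hr₂' _ (hball₂ (hmem t ht))).2⟩
    have := hγ t ht
    simp only [hwv (hball₁ (hmem t ht))] at this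
    exact this
  · have hle := hγ.1.quadratic_le_exp hsymm hc (half_pos hε) hr hQ hvdec
      (by rw [h0]; exact hstart a har) ht
    rw [h0] at hle
    refine le_of_sq_le_sq (le_of_mul_le_mul_left ?_ hc) (by positivity)
    have hexp : Real.exp (-(ε / 2) * t) = Real.exp (-(ε / 4) * t) ^ 2 := by
      rw [← Real.exp_nat_mul]; congr 1; push_cast; ring
    calc c * ‖γ t - xe‖ ^ 2 ≤ Q (γ t - xe) (γ t - xe) := hQ _
      _ ≤ Q (a - xe) (a - xe) * Real.exp (-(ε / 2) * t) := hle
      _ ≤ C ^ 2 * c * ‖a - xe‖ ^ 2 * Real.exp (-(ε / 2) * t) := by gcongr; exact hQle _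
      _ = c * (C * Real.exp (-(ε / 4) * t) * ‖a - xe‖) ^ 2 := by rw [hexp]; ring

/-! ### Routh conditions and Schwarz parameters -/

open Filter Topology in
/-- Schwarz parameters of a monic quartic shifted to the left: if `s⁴ + c₃ s³ + c₂ s² + c₁ s + c₀`
satisfies the Routh conditions, then for small `ε > 0` the polynomial `p(σ - ε)` is the
characteristic polynomial of a Schwarz matrix with positive parameters `b₀, b₁, b₂, b₃`. -/
theorem eventually_exists_schwarz_parameters {c₀ c₁ c₂ c₃ : ℝ} (hc₀ : 0 < c₀) (hc₃ : 0 < c₃)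
    (hb : 0 < c₂ - c₁ / c₃) (hd : 0 < c₁ / c₃ - c₀ / (c₂ - c₁ / c₃)) :
    ∀ᶠ ε in 𝓝[>] (0 : ℝ), ∃ b₀ > 0, ∃ b₁ > 0, ∃ b₂ > 0, ∃ b₃ > 0,
      b₃ = c₃ - 4 * ε ∧ b₀ + b₁ + b₂ = c₂ - 3 * ε * c₃ + 6 * ε ^ 2 ∧
      b₃ * (b₀ + b₁) = c₁ - 2 * ε * c₂ + 3 * ε ^ 2 * c₃ - 4 * ε ^ 3 ∧
      b₂ * b₀ = c₀ - ε * c₁ + ε ^ 2 * c₂ - ε ^ 3 * c₃ + ε ^ 4 := by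
  let a₃ : ℝ → ℝ := fun ε => c₃ - 4 * ε
  let a₁ : ℝ → ℝ := fun ε => c₁ - 2 * ε * c₂ + 3 * ε ^ 2 * c₃ - 4 * ε ^ 3
  let a₀ : ℝ → ℝ := fun ε => c₀ - ε * c₁ + ε ^ 2 * c₂ - ε ^ 3 * c₃ + ε ^ 4
  -- This is the Routh array entry of the shifted quartic; it becomes `b₂`, and matching
  -- coefficients forces the other parameters.
  let e : ℝ → ℝ := fun ε => c₂ - 3 * ε * c₃ + 6 * ε ^ 2 - a₁ ε / a₃ ε
  have h₃ : ContinuousAt a₃ 0 := by fun_prop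
  have h₁ : ContinuousAt a₁ 0 := by fun_prop
  have h₀ : ContinuousAt a₀ 0 := by fun_prop
  have hq : ContinuousAt (fun ε => a₁ ε / a₃ ε) 0 := h₁.div h₃ (by simpa [a₃] using hc₃.ne')
  have he : ContinuousAt e 0 :=
    ContinuousAt.sub (f := fun ε : ℝ => c₂ - 3 * ε * c₃ + 6 * ε ^ 2) (by fun_prop) hq
  have he0 : e 0 = c₂ - c₁ / c₃ := by simp [e, a₁, a₃]
  have hf : ContinuousAt (fun ε => a₀ ε / e ε) 0 := h₀.div he (by rw [he0]; exact hb.ne')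
  have hg : ContinuousAt (fun ε => a₁ ε / a₃ ε - a₀ ε / e ε) 0 := hq.sub hf
  have ev₃ := h₃.eventually (lt_mem_nhds (b := a₃ 0) (a := 0) (by simpa [a₃] using hc₃))
  have ev₀ := h₀.eventually (lt_mem_nhds (b := a₀ 0) (a := 0) (by simpa [a₀] using hc₀))
  have eve := he.eventually (lt_mem_nhds (b := e 0) (a := 0) (by rw [he0]; exact hb))
  have evg := hg.eventually (lt_mem_nhds (a := 0)
    (by simpa only [he0, a₁, a₃, a₀, mul_zero, zero_mul, sub_zero, add_zero, ne_eq, zero_pow,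
      OfNat.ofNat_ne_zero, not_false_eq_true] using hd))
  refine ((ev₃.and (ev₀.and (eve.and evg))).filter_mono nhdsWithin_le_nhds).mono ?_
  rintro ε ⟨p₃, p₀, pe, pg⟩
  refine ⟨a₀ ε / e ε, div_pos p₀ pe, a₁ ε / a₃ ε - a₀ ε / e ε, pg, e ε, pe, a₃ ε, p₃, rfl,
    ?_, ?_, ?_⟩
  · simp only [e]; ring
  · rw [add_sub_cancel, mul_div_cancel₀ _ p₃.ne']
  · rw [mul_div_cancel₀ _ pe.ne']

/-! ### The closed loop and its linearization -/

namespace Crane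

variable (M m grav x₀ l₀ k₁ k₂ k₃ k₄ k₅ k₆ : ℝ)

/-- The cart acceleration `(f₁ - sin θ f₂) / M` recurs in the angle and length equations, so the
input terms group around it. -/
theorem closedLoop_apply (X : Fin 6 → ℝ) :
    closedLoop M m grav x₀ l₀ (gain k₁ k₂ k₃ k₄ k₅ k₆) X =
      let f₁ := -(k₁ * (X 0 - x₀) + k₂ * X 1 + k₃ * X 2 + k₄ * X 3)
      let f₂ := -(m * grav) - (k₅ * (X 4 - l₀) + k₆ * X 5)
      ![X 1,
        (f₁ - Real.sin (X 2) * f₂) / M,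
        X 3,
        (-(2 * X 5 * X 3) - grav * Real.sin (X 2)
          - Real.cos (X 2) * ((f₁ - Real.sin (X 2) * f₂) / M)) / X 4,
        X 5,
        X 4 * X 3 ^ 2 + grav * Real.cos (X 2)
          - Real.sin (X 2) * ((f₁ - Real.sin (X 2) * f₂) / M) + f₂ / m] := by
  extract_lets f₁ f₂
  have hF : eqInput m grav + -(gain k₁ k₂ k₃ k₄ k₅ k₆ *ᵥ (X - eqState x₀ l₀)) = ![f₁, f₂] := by
    ext i
    fin_cases i <;>
      simp [eqInput, gain, eqState, vecHead, vecTail, f₁, f₂] <;> ring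
  rw [closedLoop, hF, dynamics]
  clear_value f₁ f₂
  ext i
  fin_cases i <;>
    simp [drift, inputMatrix] <;> ring

theorem contDiffAt_closedLoop {X : Fin 6 → ℝ} (hX : X 4 ≠ 0) :
    ContDiffAt ℝ 1 (closedLoop M m grav x₀ l₀ (gain k₁ k₂ k₃ k₄ k₅ k₆)) X := by
  have hp : ∀ i : Fin 6, ContDiffAt ℝ 1 (fun X : Fin 6 → ℝ => X i) X := fun i => by fun_prop
  rw [funext (closedLoop_apply M m grav x₀ l₀ k₁ k₂ k₃ k₄ k₅ k₆), contDiffAt_pi]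
  intro i
  fin_cases i
  · simpa using hp 1
  · simp only [Fin.mk_one, Matrix.cons_val]; fun_prop
  · simpa using hp 3
  · simp only [Fin.reduceFinMk, Matrix.cons_val]; fun_prop (disch := exact hX)
  · simpa using hp 5
  · simp only [Fin.reduceFinMk, Matrix.cons_val]; fun_prop

/-- The linearization of the closed loop at the equilibrium. -/
theorem fderiv_closedLoop (hl₀ : l₀ ≠ 0) (h : Fin 6 → ℝ) :
    fderiv ℝ (closedLoop M m grav x₀ l₀ (gain k₁ k₂ k₃ k₄ k₅ k₆)) (eqState x₀ l₀) h =
      let a := (-(k₁ * h 0 + k₂ * h 1 + k₃ * h 2 + k₄ * h 3) + m * grav * h 2) / M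
      ![h 1, a, h 3, (-(grav * h 2) - a) / l₀, h 5, -(k₅ * h 4 + k₆ * h 5) / m] := by
  have hline : HasDerivAt (fun s : ℝ => eqState x₀ l₀ + s • h) h 0 := by
    simpa using ((hasDerivAt_id (0 : ℝ)).smul_const h).const_add (eqState x₀ l₀)
  have hdiff := (contDiffAt_closedLoop M m grav x₀ l₀ k₁ k₂ k₃ k₄ k₅ k₆
    (X := eqState x₀ l₀) (by simpa [eqState] using hl₀)).differentiableAt one_ne_zero
  have hcomp := HasFDerivAt.comp_hasDerivAt_of_eq (0 : ℝ) hdiff.hasFDerivAt hline (by simp)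
  refine hcomp.unique ?_
  have hx : ∀ i, HasDerivAt (fun s : ℝ => (eqState x₀ l₀ + s • h) i) (h i) 0 :=
    hasDerivAt_pi.1 hline
  have hsin := (hx 2).sin
  have hcos := (hx 2).cos
  have hf₁ := (((((hx 0).sub_const x₀).const_mul k₁).add ((hx 1).const_mul k₂)).add
    ((hx 2).const_mul k₃)).add ((hx 3).const_mul k₄) |>.neg
  have hf₂ := ((((hx 4).sub_const l₀).const_mul k₅).add ((hx 5).const_mul k₆)).const_sub
    (-(m * grav))
  have ha := (hf₁.sub (hsin.mul hf₂)).div_const M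
  have h4 : (eqState x₀ l₀ + (0 : ℝ) • h) 4 ≠ 0 := by simpa [eqState] using hl₀
  have hc3 := ((((((hx 5).const_mul 2).mul (hx 3)).neg).sub (hsin.const_mul grav)).sub
    (hcos.mul ha)).div (hx 4) h4
  have hc5 := ((((hx 4).mul ((hx 3).pow 2)).add (hcos.const_mul grav)).sub
    (hsin.mul ha)).add (hf₂.div_const m)
  rw [show closedLoop M m grav x₀ l₀ (gain k₁ k₂ k₃ k₄ k₅ k₆) = _ from
    funext (closedLoop_apply M m grav x₀ l₀ k₁ k₂ k₃ k₄ k₅ k₆)]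
  refine hasDerivAt_pi.2 fun i => ?_
  fin_cases i
  · simpa using hx 1
  · refine ha.congr_deriv ?_
    simp [eqState]
    ring
  · simpa using hx 3
  · refine hc3.congr_deriv ?_
    simp [eqState]
    field_simp
  · simpa using hx 5
  · refine hc5.congr_deriv ?_
    simp [eqState]

end Crane

/-! ### The Lyapunov function of the linearized crane -/

namespace Crane

open Filter Topology in
/-- A quadratic Lyapunov function for the linearized closed loop. The pendulum-cart subsystem is a
fourth-order equation for the flat output `x + l₀ θ`, the length subsystem a second-order one. -/
theorem exists_quadratic_lyapunov {M m grav : ℝ} (hM : 0 < M) (hm : 0 < m) (hgrav : 0 < grav)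
    (x₀ : ℝ) {l₀ : ℝ} (hl₀ : 0 < l₀) {k₁ k₂ k₃ k₄ k₅ k₆ c₀ c₁ c₂ c₃ : ℝ}
    (hc₀ : c₀ = k₁ * grav / (M * l₀)) (hc₁ : c₁ = k₂ * grav / (M * l₀))
    (hc₂ : c₂ = (M * grav + k₁ * l₀ + m * grav - k₃) / (M * l₀))
    (hc₃ : c₃ = (k₂ * l₀ - k₄) / (M * l₀)) (h₀ : 0 < c₀) (h₃ : 0 < c₃) (hb : 0 < c₂ - c₁ / c₃)
    (hd : 0 < c₁ / c₃ - c₀ / (c₂ - c₁ / c₃)) (h₅ : 0 < k₅) (h₆ : 0 < k₆) :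
    ∃ Q : (Fin 6 → ℝ) →L[ℝ] (Fin 6 → ℝ) →L[ℝ] ℝ, (∀ x y, Q x y = Q y x) ∧
      (∀ x, x ≠ 0 → 0 < Q x x) ∧ ∃ ε > 0, ∀ x, Q x
        (fderiv ℝ (closedLoop M m grav x₀ l₀ (gain k₁ k₂ k₃ k₄ k₅ k₆)) (eqState x₀ l₀) x) ≤
          -ε * Q x x := by
  have hlen : ∀ᶠ ε in 𝓝[>] (0 : ℝ), 0 < k₆ / m - 2 * ε ∧ 0 < k₅ / m - ε * (k₆ / m) + ε ^ 2 := by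
    have e₁ : ContinuousAt (fun ε : ℝ => k₆ / m - 2 * ε) 0 := by fun_prop
    have e₀ : ContinuousAt (fun ε : ℝ => k₅ / m - ε * (k₆ / m) + ε ^ 2) 0 := by fun_prop
    have p₁ : 0 < k₆ / m := div_pos h₆ hm
    have p₀ : 0 < k₅ / m := div_pos h₅ hm
    exact ((e₁.eventually (lt_mem_nhds (by simpa using p₁))).and
      (e₀.eventually (lt_mem_nhds (by simpa using p₀)))).filter_mono nhdsWithin_le_nhds
  obtain ⟨ε, ⟨⟨b₀, hb₀, b₁, hb₁, b₂, hb₂, b₃, hb₃, E₃, E₂, E₁, E₀⟩, he₁, he₀⟩, hε⟩ :=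
    (((eventually_exists_schwarz_parameters h₀ h₃ hb hd).and hlen).and
      self_mem_nhdsWithin).exists
  have hε : 0 < ε := hε
  let p : Fin 6 → (Fin 6 → ℝ) →L[ℝ] ℝ := fun i => ContinuousLinearMap.proj i
  -- The `zᵢ` are the successive time derivatives of the flat output along the linear flow. With `D`
  -- the time derivative, the `yᵢ` satisfy `y₁ = (D + ε) z₀`, `y₂ = (D + ε) y₁ + b₀ z₀`, `y₃ = (D +
  -- ε) y₂ + b₁ y₁`.
  let z₀ := p 0 + l₀ • p 2
  let z₁ := p 1 + l₀ • p 3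
  let z₂ := -grav • p 2
  let z₃ := -grav • p 3
  let y₁ := z₁ + ε • z₀
  let y₂ := z₂ + (2 * ε) • z₁ + (ε ^ 2 + b₀) • z₀
  let y₃ := z₃ + (3 * ε) • z₂ + (3 * ε ^ 2 + b₀ + b₁) • z₁
    + (ε ^ 3 + ε * b₀ + b₁ * ε) • z₀
  let u₁ := p 5 + ε • p 4
  set e₀ := k₅ / m - ε * (k₆ / m) + ε ^ 2 with he₀'
  set e₁ := k₆ / m - 2 * ε with he₁'
  -- These weights make the off-diagonal terms of the Schwarz system cancel in pairs.
  let Q : (Fin 6 → ℝ) →L[ℝ] (Fin 6 → ℝ) →L[ℝ] ℝ :=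
    (b₀ * b₁ * b₂) • z₀.smulRight z₀ + (b₁ * b₂) • y₁.smulRight y₁ + b₂ • y₂.smulRight y₂
      + y₃.smulRight y₃ + e₀ • (p 4).smulRight (p 4) + u₁.smulRight u₁
  have hQ : ∀ x y, Q x y = b₀ * b₁ * b₂ * (z₀ x * z₀ y) + b₁ * b₂ * (y₁ x * y₁ y)
      + b₂ * (y₂ x * y₂ y) + y₃ x * y₃ y + e₀ * (p 4 x * p 4 y) + u₁ x * u₁ y := fun x y => rfl
  have hz₀ : ∀ x, z₀ x = x 0 + l₀ * x 2 := fun x => rfl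
  have hz₁ : ∀ x, z₁ x = x 1 + l₀ * x 3 := fun x => rfl
  have hz₂ : ∀ x, z₂ x = -grav * x 2 := fun x => rfl
  have hz₃ : ∀ x, z₃ x = -grav * x 3 := fun x => rfl
  have hy₁ : ∀ x, y₁ x = z₁ x + ε * z₀ x := fun x => rfl
  have hy₂ : ∀ x, y₂ x = z₂ x + 2 * ε * z₁ x + (ε ^ 2 + b₀) * z₀ x := fun x => rfl
  have hy₃ : ∀ x, y₃ x = z₃ x + 3 * ε * z₂ x + (3 * ε ^ 2 + b₀ + b₁) * z₁ x
    + (ε ^ 3 + ε * b₀ + b₁ * ε) * z₀ x := fun x => rfl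
  have hu₁ : ∀ x, u₁ x = x 5 + ε * x 4 := fun x => rfl
  have hp₄ : ∀ x, p 4 x = x 4 := fun x => rfl
  clear_value Q z₀ z₁ z₂ z₃ y₁ y₂ y₃ u₁ p
  refine ⟨Q, fun x y => by rw [hQ, hQ]; ring, fun x hx => ?_, ε, hε, fun x => ?_⟩
  · have hnn : 0 ≤ Q x x := by
      rw [hQ]
      have := mul_self_nonneg (z₀ x)
      have := mul_self_nonneg (y₁ x)
      have := mul_self_nonneg (y₂ x)
      have := mul_self_nonneg (y₃ x)
      have := mul_self_nonneg (p 4 x)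
      have := mul_self_nonneg (u₁ x)
      positivity
    refine lt_of_le_of_ne hnn fun h => hx ?_
    rw [hQ] at h
    have q₀ : 0 ≤ b₀ * b₁ * b₂ * (z₀ x * z₀ x) := mul_nonneg (by positivity) (mul_self_nonneg _)
    have q₁ : 0 ≤ b₁ * b₂ * (y₁ x * y₁ x) := mul_nonneg (by positivity) (mul_self_nonneg _)
    have q₂ : 0 ≤ b₂ * (y₂ x * y₂ x) := mul_nonneg (by positivity) (mul_self_nonneg _)
    have q₃ : 0 ≤ y₃ x * y₃ x := mul_self_nonneg _
    have q₄ : 0 ≤ e₀ * (p 4 x * p 4 x) := mul_nonneg (by positivity) (mul_self_nonneg _)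
    have q₅ : 0 ≤ u₁ x * u₁ x := mul_self_nonneg _
    have r₀ : z₀ x = 0 := by
      have : b₀ * b₁ * b₂ * (z₀ x * z₀ x) = 0 := by linarith
      simpa [hb₀.ne', hb₁.ne', hb₂.ne'] using this
    have r₁ : y₁ x = 0 := by
      have : b₁ * b₂ * (y₁ x * y₁ x) = 0 := by linarith
      simpa [hb₁.ne', hb₂.ne'] using this
    have r₂ : y₂ x = 0 := by
      have : b₂ * (y₂ x * y₂ x) = 0 := by linarith
      simpa [hb₂.ne'] using this
    have r₃ : y₃ x = 0 := by
      have : y₃ x * y₃ x = 0 := by linarith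
      simpa using this
    have r₄ : x 4 = 0 := by
      have : e₀ * (p 4 x * p 4 x) = 0 := by linarith
      simpa [he₀.ne', hp₄] using this
    have r₅ : u₁ x = 0 := by
      have : u₁ x * u₁ x = 0 := by linarith
      simpa using this
    rw [hy₁, r₀] at r₁
    have s₁ : z₁ x = 0 := by linarith
    rw [hy₂, r₀, s₁, hz₂] at r₂
    have s₂ : x 2 = 0 := by simpa [hgrav.ne'] using r₂
    rw [hy₃, r₀, s₁, hz₂, s₂, hz₃] at r₃
    have s₃ : x 3 = 0 := by simpa [hgrav.ne'] using r₃
    rw [hz₁, s₃] at s₁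
    rw [hz₀, s₂] at r₀
    rw [hu₁, r₄] at r₅
    funext i
    fin_cases i
    · simpa using r₀
    · simpa using s₁
    · exact s₂
    · exact s₃
    · exact r₄
    · simpa using r₅
  · rw [fderiv_closedLoop _ _ _ _ _ _ _ _ _ _ _ hl₀.ne']
    extract_lets a
    set d : Fin 6 → ℝ := ![x 1, a, x 3, (-(grav * x 2) - a) / l₀, x 5,
      -(k₅ * x 4 + k₆ * x 5) / m] with hd
    have d₀ : d 0 = x 1 := rfl
    have d₁ : d 1 = a := rfl
    have d₂ : d 2 = x 3 := rfl
    have d₃ : d 3 = (-(grav * x 2) - a) / l₀ := rfl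
    have d₄ : d 4 = x 5 := rfl
    have d₅ : d 5 = -(k₅ * x 4 + k₆ * x 5) / m := rfl
    have Z₀ : z₀ d = z₁ x := by rw [hz₀, hz₁, d₀, d₂]
    have Z₁ : z₁ d = z₂ x := by rw [hz₁, hz₂, d₁, d₃]; field_simp; ring
    have Z₂ : z₂ d = z₃ x := by rw [hz₂, hz₃, d₂]
    have Z₃ : z₃ d = -(c₃ * z₃ x + c₂ * z₂ x + c₁ * z₁ x + c₀ * z₀ x) := by
      rw [hz₃, hz₃, hz₂, hz₁, hz₀, d₃, hc₀, hc₁, hc₂, hc₃]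
      simp only [a]
      field_simp
      ring
    have Y₀ : z₀ d = y₁ x - ε * z₀ x := by rw [Z₀, hy₁]; ring
    have Y₁ : y₁ d = y₂ x - b₀ * z₀ x - ε * y₁ x := by rw [hy₁, hy₂, hy₁, Z₀, Z₁]; ring
    have Y₂ : y₂ d = y₃ x - b₁ * y₁ x - ε * y₂ x := by
      rw [hy₂, hy₃, hy₁, hy₂, Z₀, Z₁, Z₂]; ring
    have Y₃ : y₃ d = -b₂ * y₂ x - b₃ * y₃ x - ε * y₃ x := by
      rw [hy₃, hy₂, hy₃, Z₀, Z₁, Z₂, Z₃]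
      -- The multipliers are `(D + ε)ᵏ z₀` for `k = 3, 2, 1, 0`, matching the powers of the shifted
      -- variable.
      linear_combination (z₃ x + 3 * ε * z₂ x + 3 * ε ^ 2 * z₁ x + ε ^ 3 * z₀ x) * E₃
        + (z₂ x + 2 * ε * z₁ x + ε ^ 2 * z₀ x) * E₂ + (z₁ x + ε * z₀ x) * E₁ + z₀ x * E₀
    have U₀ : p 4 d = u₁ x - ε * p 4 x := by rw [hp₄, hp₄, d₄, hu₁]; ring
    have U₁ : u₁ d = -e₀ * p 4 x - e₁ * u₁ x - ε * u₁ x := by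
      rw [hu₁, d₄, d₅, hp₄, hu₁, he₀', he₁']; field_simp; ring
    rw [hQ, hQ, Y₀, Y₁, Y₂, Y₃, U₀, U₁]
    have w₃ : 0 ≤ b₃ * (y₃ x * y₃ x) := mul_nonneg hb₃.le (mul_self_nonneg _)
    have w₅ : 0 ≤ e₁ * (u₁ x * u₁ x) := mul_nonneg he₁.le (mul_self_nonneg _)
    -- After cancellation the derivative is exactly `-ε Q - b₃ y₃² - e₁ u₁²`.
    linarith

/-- The input `F_eq` makes `X_eq` an equilibrium. -/
theorem dynamics_eqState {m : ℝ} (hm : m ≠ 0) (M grav x₀ l₀ : ℝ) :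
    dynamics M m grav (eqState x₀ l₀) (eqInput m grav) = 0 := by
  ext i
  fin_cases i <;>
    simp [dynamics, drift, inputMatrix, eqState, eqInput]
  field_simp
  ring

end Crane

/-! ### From the gain inequalities to the Routh conditions -/

theorem lemma1 (M m grav : ℝ) (hM : 0 < M) (hm : 0 < m) (hgrav : 0 < grav)
    (x₀ l₀ : ℝ) (hl₀ : 0 < l₀) (k₁ k₂ k₃ k₄ k₅ k₆ : ℝ)
    (h₁ : 0 < k₁) (h₂ : 0 < k₂ * l₀ - k₄)
    (h₃ : 0 < -k₄ * M * grav / (k₂ * l₀ - k₄) + k₁ * l₀ - k₃ + m * grav)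
    (h₄ : 0 < (-k₂ * k₄ * M * grav
          + (k₂ * l₀ - k₄) * (k₁ * k₄ - k₂ * k₃ + k₂ * m * grav)) /
        (-k₄ * M * grav + (k₂ * l₀ - k₄) * (k₁ * l₀ - k₃ + m * grav)))
    (h₅ : 0 < k₅) (h₆ : 0 < k₆) :
    Crane.dynamics M m grav (Crane.eqState x₀ l₀) (Crane.eqInput m grav) = 0 ∧
    IsExponentiallyStableEquilibrium
      (Crane.closedLoop M m grav x₀ l₀ (Crane.gain k₁ k₂ k₃ k₄ k₅ k₆))
      Crane.phaseSpace (Crane.eqState x₀ l₀) := by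
  have heq := Crane.dynamics_eqState hm.ne' M grav x₀ l₀
  refine ⟨heq, ?_⟩
  have h₂' := h₂.ne'
  have hMl : 0 < M * l₀ := mul_pos hM hl₀
  -- The denominator in `h₄` is the product of the quantities in `h₂` and `h₃`, hence positive.
  have hD : -k₄ * M * grav + (k₂ * l₀ - k₄) * (k₁ * l₀ - k₃ + m * grav)
      = (k₂ * l₀ - k₄)
        * (-k₄ * M * grav / (k₂ * l₀ - k₄) + k₁ * l₀ - k₃ + m * grav) := by
    field_simp
    ring
  have hDpos := mul_pos h₂ h₃
  rw [← hD] at hDpos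
  have hb : (M * grav + k₁ * l₀ + m * grav - k₃) / (M * l₀)
        - k₂ * grav / (M * l₀) / ((k₂ * l₀ - k₄) / (M * l₀))
      = (-k₄ * M * grav + (k₂ * l₀ - k₄) * (k₁ * l₀ - k₃ + m * grav))
        / ((k₂ * l₀ - k₄) * (M * l₀)) := by
    obtain ⟨P, hP⟩ : ∃ P, P = k₂ * l₀ - k₄ := ⟨_, rfl⟩
    rw [← hP] at h₂' ⊢
    field_simp
    rw [hP]
    ring
  -- The last Routh quantity is `grav / (k₂ * l₀ - k₄)` times the quotient in `h₄`. An abstract `D`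
  -- lets `field_simp` treat the denominator as an atom.
  have hd : ∀ D, D ≠ 0 → D = -k₄ * M * grav + (k₂ * l₀ - k₄) * (k₁ * l₀ - k₃ + m * grav) →
      k₂ * grav / (M * l₀) / ((k₂ * l₀ - k₄) / (M * l₀)) - k₁ * grav / (M * l₀) /
        (D / ((k₂ * l₀ - k₄) * (M * l₀)))
      = grav / (k₂ * l₀ - k₄) * ((-k₂ * k₄ * M * grav
        + (k₂ * l₀ - k₄) * (k₁ * k₄ - k₂ * k₃ + k₂ * m * grav)) / D) := by
    intro D hD0 hDeq
    field_simp
    rw [hDeq]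
    ring
  obtain ⟨Q, hsymm, hpos, ε, hε, hdec⟩ :=
    Crane.exists_quadratic_lyapunov hM hm hgrav x₀ hl₀ (k₁ := k₁) (k₂ := k₂) (k₃ := k₃) (k₄ := k₄)
      rfl rfl rfl rfl (by positivity) (by positivity) (by rw [hb]; positivity)
      (by
        rw [hb, hd _ hDpos.ne' rfl]
        positivity) h₅ h₆
  have hl : (Crane.eqState x₀ l₀) 4 = l₀ := rfl
  refine isExponentiallyStableEquilibrium_of_quadratic ?_ ?_
    (Crane.contDiffAt_closedLoop _ _ _ _ _ _ _ _ _ _ _ (by rw [hl]; exact hl₀.ne'))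
    hsymm hpos hε hdec
  · exact (isOpen_lt continuous_const (continuous_apply 4)).mem_nhds
      (show 0 < (Crane.eqState x₀ l₀) 4 from hl₀)
  · simpa [Crane.closedLoop] using heq
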